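/- Let $Q$ be an $n$-dimensional smooth manifold and let $G$ be a Lie group with Lie algebra $\mathfrak g=T_eG$, acting smoothly on $Q$ from the left, $\Phi_g(q)=g\cdot q$. Let $G$ act on $T^*Q$ by cotangent lifts: for $\alpha\in T_q^*Q$, the covector $g\cdot\alpha\in T^*_{g\cdot q}Q$ is given by $$\langle g\cdot\alpha, v\rangle=\langle\alpha, T\Phi_{g^{-1}}(v)\rangle,\qquad v\in T_{g\cdot q}Q .$$ For a smooth action of $G$ on a manifold $P$ and $\xi\in\mathfrak g$, let $\xi_P$ denote the infinitesimal generator, $\xi_P(x)=\frac{d}{dt}\big|_{t=0}\,g(t)\cdot x$ for any path $g(t)$ in $G$ with $g(0)=e$ and $g'(0)=\xi$. Each chart $(q^1,\dots,q^n)$ of $Q$ induces cotangent-lifted coordinates $(q^1,\dots,q^n,p_1,\dots,p_n)$ on $T^*Q$ by writing covectors as $\sum_i p_i\,dq^i$. The classical Poisson bracket of smooth functions $F,K$ on $T^*Q$ is $$\{F,K\}=\sum_{i=1}^n\left(\frac{\partial F}{\partial q^i}\frac{\partial K}{\partial p_i}-\frac{\partial F}{\partial p_i}\frac{\partial K}{\partial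 q^i}\right).$$ Theorem. This bracket does not depend on the choice of the chart of $Q$, and the cotangent-lifted action of $G$ on $T^*Q$ is smooth. The map $J:T^*Q\to\mathfrak g^*$ defined by $$J_\xi(\alpha_q):=\langle J(\alpha_q),\xi\rangle=\langle\alpha_q,\xi_Q(q)\rangle,\qquad \xi\in\mathfrak g,\ \alpha_q\in T^*_qQ,$$ is a momentum map for the action of $G$ on $T^*Q$ with respect to the classical Poisson bracket. That is, the action is canonical, $$\{F\circ g,\,K\circ g\}=\{F,K\}\circ g\quad\text{for all } g\in G \text{ and all smooth } F,K:T^*Q\to\mathbb R$$ (where $g$ also denotes the map $\alpha\mapsto g\cdot\alpha$ of $T^*Q$), and for every $\xi\in\mathfrak g$ the function $J_\xi$ is smooth and its Hamiltonian vector field is $X_{J_\xi}=\xi_{T^*Q}$, i.e. $\xi_{T^*Q}[F]=\{F,J_\xi\}$ for every smooth $F:T^*Q\to\mathbb R$. -/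

import Mathlib

open scoped Manifold ContDiff
open Bundle

noncomputable section

/-- The model `ℝⁿ` of an `n`-dimensional manifold. -/
abbrev Model (n : ℕ) : Type := EuclideanSpace ℝ (Fin n)

/-- The cotangent bundle `T*Q` of an `n`-dimensional smooth manifold `Q`: its points are pairs
`⟨q, α⟩` with `q : Q` and `α` a linear form on the tangent space `T_q Q`. The vector bundle and
manifold structures are Mathlib's structures on a bundle of continuous linear maps. -/
abbrev CotangentBundle (n : ℕ) (Q : Type*) [TopologicalSpace Q] [ChartedSpace (Model n) Q]
    [IsManifold (𝓡 n) ∞ Q] : Type _ :=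
  TotalSpace (Model n →L[ℝ] ℝ)
    (fun q : Q => TangentSpace (𝓡 n) q →L[ℝ] Bundle.Trivial Q ℝ q)

/-- The model with corners of the smooth manifold `T*Q`. -/
abbrev cotangentModel (n : ℕ) :
    ModelWithCorners ℝ (Model n × (Model n →L[ℝ] ℝ)) (ModelProd (Model n) (Model n →L[ℝ] ℝ)) :=
  (𝓡 n).prod 𝓘(ℝ, Model n →L[ℝ] ℝ)

section Poisson

/-! ### Hamiltonian vector fields and momentum maps

The manifold `P` carries a bracket `B` of real functions; only its values on smooth functions
matter. -/

variable {EP : Type*} [NormedAddCommGroup EP] [NormedSpace ℝ EP]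
  {HP : Type*} [TopologicalSpace HP] (IP : ModelWithCorners ℝ EP HP)
  {P : Type*} [TopologicalSpace P] [ChartedSpace HP P]

/-- `X` is the Hamiltonian vector field `X_H` of the function `H` for the bracket `B`:
`X_H(F) = {F, H}` for all smooth `F`. -/
def IsHamiltonianVectorField (B : (P → ℝ) → (P → ℝ) → P → ℝ)
    (X : (x : P) → TangentSpace IP x) (H : P → ℝ) : Prop :=
  ∀ F : P → ℝ, ContMDiff IP 𝓘(ℝ, ℝ) ∞ F → ∀ x : P, mvfderiv IP F x (X x) = B F H x

/-- The action of `G` on `P` is canonical: every `g` acts by a map that preserves the bracket. -/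
def IsCanonicalAction (B : (P → ℝ) → (P → ℝ) → P → ℝ) (G : Type*) [Group G] [MulAction G P] :
    Prop :=
  ∀ (g : G) (F K : P → ℝ), ContMDiff IP 𝓘(ℝ, ℝ) ∞ F → ContMDiff IP 𝓘(ℝ, ℝ) ∞ K →
    ∀ x : P, B (fun y => F (g • y)) (fun y => K (g • y)) x = B F K (g • x)

variable {m : ℕ} {G : Type*} [TopologicalSpace G] [ChartedSpace (Model m) G] [Group G]

/-- The infinitesimal generator `ξ_P` of an action of `G` on `P`: `ξ_P(x)` is the image of `ξ`
under the derivative at `1` of the orbit map `g ↦ g • x`. This derivative takes values in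
`T_{1 • x} P`, which is `T_x P`. -/
def infinitesimalGenerator [MulAction G P] (ξ : GroupLieAlgebra (𝓡 m) G) (x : P) :
    TangentSpace IP x :=
  (mfderiv (𝓡 m) IP (fun g : G => g • x) 1 : TangentSpace (𝓡 m) (1 : G) →L[ℝ] TangentSpace IP x) ξ

/-- `ξ_P(x)` is the velocity at `t = 0` of `g(t) • x` for any path with `g(0) = 1`, `g'(0) = ξ`. -/
theorem tangentMap_path_smul [MulAction G P] (ξ : GroupLieAlgebra (𝓡 m) G) (x : P)
    (hx : MDifferentiableAt (𝓡 m) IP (fun g : G => g • x) 1) (c : ℝ → G)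
    (hc : MDifferentiableAt 𝓘(ℝ, ℝ) (𝓡 m) c 0)
    (hξ : tangentMap 𝓘(ℝ, ℝ) (𝓡 m) c ⟨0, (1 : ℝ)⟩ = ⟨1, ξ⟩) :
    tangentMap 𝓘(ℝ, ℝ) IP (fun t => c t • x) ⟨0, (1 : ℝ)⟩ =
      ⟨x, infinitesimalGenerator IP ξ x⟩ := by
  have h0 : c 0 = 1 := congrArg TotalSpace.proj hξ
  have hx' : MDifferentiableAt (𝓡 m) IP (fun g : G => g • x) (c 0) := by rwa [h0]
  have h1 := tangentMap_comp_at (I := 𝓘(ℝ, ℝ)) (I' := 𝓡 m) (I'' := IP) (f := c)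
    (g := fun g : G => g • x) ⟨(0 : ℝ), (1 : ℝ)⟩ hx' hc
  rw [hξ] at h1
  refine h1.trans ?_
  refine TotalSpace.ext (one_smul G x) ?_
  exact HEq.rfl

/-- `J : P → 𝔤*` is a momentum map for the action of `G` on `P` with respect to the bracket `B`:
the action is canonical, and for every `ξ` the function `J_ξ = ⟨J(·), ξ⟩` is smooth with
`X_{J_ξ} = ξ_P`. -/
structure IsMomentumMap [MulAction G P] (B : (P → ℝ) → (P → ℝ) → P → ℝ)
    (J : P → (GroupLieAlgebra (𝓡 m) G →L[ℝ] ℝ)) : Prop where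
  canonical : IsCanonicalAction IP B G
  smooth : ∀ ξ : GroupLieAlgebra (𝓡 m) G, ContMDiff IP 𝓘(ℝ, ℝ) ∞ (fun x => J x ξ)
  hamiltonian : ∀ ξ : GroupLieAlgebra (𝓡 m) G,
    IsHamiltonianVectorField IP B (infinitesimalGenerator IP ξ) (fun x => J x ξ)

end Poisson

section Cotangent

variable {n : ℕ}
  {Q : Type*} [TopologicalSpace Q] [ChartedSpace (Model n) Q] [IsManifold (𝓡 n) ∞ Q]
  {S : Type*} [TopologicalSpace S] [ChartedSpace (Model n) S] [IsManifold (𝓡 n) ∞ S]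

/-! ### The classical Poisson bracket -/

/-- The coordinate one-forms `dqⁱ` of a chart. -/
def coordForm (e : OpenPartialHomeomorph Q (Model n)) (i : Fin n) (x : Q) :
    TangentSpace (𝓡 n) x →L[ℝ] ℝ :=
  mvfderiv (𝓡 n) (fun y => e y i) x

/-- The coordinate vector fields `∂/∂qⁱ` of a chart: at `x` in its domain, the velocity at `t = 0`
of `t ↦ e⁻¹(e(x) + t eᵢ)`, a vector in `T_{e⁻¹(e(x))} Q`, which is `T_x Q`. -/
def coordVector (e : OpenPartialHomeomorph Q (Model n)) (i : Fin n) (x : Q) :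
    TangentSpace (𝓡 n) x :=
  (mfderiv (𝓡 n) (𝓡 n) e.symm (e x) :
    TangentSpace (𝓡 n) (e x) →L[ℝ] TangentSpace (𝓡 n) x) (EuclideanSpace.single i (1 : ℝ))

/-- The point of `T*Q` with cotangent-lifted coordinates `(q, p)`: the covector `∑ pᵢ dqⁱ` at the
point of `Q` with coordinates `q`. -/
def cotangentPoint (e : OpenPartialHomeomorph Q (Model n)) (q p : Model n) : CotangentBundle n Q :=
  ⟨e.symm q, ∑ i, p i • coordForm e i (e.symm q)⟩

/-- The coordinates `pᵢ = ⟨α, ∂/∂qⁱ⟩` of a covector `α`. -/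
def momentumCoord (e : OpenPartialHomeomorph Q (Model n)) (α : CotangentBundle n Q) : Model n :=
  WithLp.toLp 2 fun i => α.2 (coordVector e i α.1)

/-- `∂F/∂qⁱ` at `α` in the cotangent-lifted coordinates of the chart `e`. -/
def partialQ (e : OpenPartialHomeomorph Q (Model n)) (i : Fin n) (F : CotangentBundle n Q → ℝ)
    (α : CotangentBundle n Q) : ℝ :=
  lineDeriv ℝ (fun q => F (cotangentPoint e q (momentumCoord e α))) (e α.1)
    (EuclideanSpace.single i (1 : ℝ))

/-- `∂F/∂pᵢ` at `α` in the cotangent-lifted coordinates of the chart `e`. -/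
def partialP (e : OpenPartialHomeomorph Q (Model n)) (i : Fin n) (F : CotangentBundle n Q → ℝ)
    (α : CotangentBundle n Q) : ℝ :=
  lineDeriv ℝ (fun p => F (cotangentPoint e (e α.1) p)) (momentumCoord e α)
    (EuclideanSpace.single i (1 : ℝ))

/-- The expression `∑ᵢ (∂F/∂qⁱ ∂K/∂pᵢ - ∂F/∂pᵢ ∂K/∂qⁱ)` in the cotangent-lifted coordinates of the
chart `e`, at a covector `α` based in the domain of `e`. -/
def poissonBracketIn (e : OpenPartialHomeomorph Q (Model n)) (F K : CotangentBundle n Q → ℝ)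
    (α : CotangentBundle n Q) : ℝ :=
  ∑ i, (partialQ e i F α * partialP e i K α - partialP e i F α * partialQ e i K α)

/-- The classical Poisson bracket on `T*Q`; at `α` it is computed in the preferred chart at the
base point of `α`. -/
def classicalBracket (F K : CotangentBundle n Q → ℝ) (α : CotangentBundle n Q) : ℝ :=
  poissonBracketIn (chartAt (Model n) α.1) F K α

/-! ### Cotangent lifts -/

/-- The cotangent lift `T*f : T*S → T*Q` of a diffeomorphism `f : Q → S`. It sends `α ∈ T*_s S` to
the covector `v ↦ ⟨α, Tf(v)⟩` at `q = f⁻¹(s)`; here `Tf(v)` lies in `T_{f(q)} S`, which is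
`T_s S`. -/
def cotangentLift (f : Q ≃ₘ^∞⟮𝓡 n, 𝓡 n⟯ S) (α : CotangentBundle n S) : CotangentBundle n Q :=
  ⟨f.symm α.1, ContinuousLinearMap.comp (α.2 : TangentSpace (𝓡 n) α.1 →L[ℝ] ℝ)
    (mfderiv (𝓡 n) (𝓡 n) f (f.symm α.1) :
      TangentSpace (𝓡 n) (f.symm α.1) →L[ℝ] TangentSpace (𝓡 n) α.1)⟩

/-- `T*f(α) = α ∘ T_q f` for `α ∈ T*_{f(q)} S`. -/
theorem cotangentLift_mk (f : Q ≃ₘ^∞⟮𝓡 n, 𝓡 n⟯ S) (q : Q)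
    (a : TangentSpace (𝓡 n) (f q) →L[ℝ] ℝ) :
    cotangentLift f ⟨f q, a⟩ = ⟨q, a.comp (mfderiv (𝓡 n) (𝓡 n) f q)⟩ := by
  have key : ∀ q' : Q, q' = q →
      (⟨q', ContinuousLinearMap.comp (a : Model n →L[ℝ] ℝ)
        (mfderiv (𝓡 n) (𝓡 n) f q' : Model n →L[ℝ] Model n)⟩ : CotangentBundle n Q) =
      ⟨q, ContinuousLinearMap.comp (a : Model n →L[ℝ] ℝ)
        (mfderiv (𝓡 n) (𝓡 n) f q : Model n →L[ℝ] Model n)⟩ := by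
    rintro q' rfl; rfl
  exact key _ (f.symm_apply_apply q)

theorem cotangentLift_refl (α : CotangentBundle n Q) :
    cotangentLift (Diffeomorph.refl (𝓡 n) Q ∞) α = α := by
  obtain ⟨q, a⟩ := α
  refine (cotangentLift_mk (Diffeomorph.refl (𝓡 n) Q ∞) q a).trans ?_
  have h : mfderiv (𝓡 n) (𝓡 n) (Diffeomorph.refl (𝓡 n) Q ∞) q =
      ContinuousLinearMap.id ℝ (TangentSpace (𝓡 n) q) := mfderiv_id
  rw [h]
  rfl

theorem cotangentLift_trans {R : Type*} [TopologicalSpace R] [ChartedSpace (Model n) R]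
    [IsManifold (𝓡 n) ∞ R] (f : Q ≃ₘ^∞⟮𝓡 n, 𝓡 n⟯ S) (k : S ≃ₘ^∞⟮𝓡 n, 𝓡 n⟯ R)
    (α : CotangentBundle n R) :
    cotangentLift (f.trans k) α = cotangentLift f (cotangentLift k α) := by
  obtain ⟨r, a⟩ := α
  obtain ⟨s, rfl⟩ := k.surjective r
  obtain ⟨q, rfl⟩ := f.surjective s
  have h : mfderiv (𝓡 n) (𝓡 n) (f.trans k) q =
      (mfderiv (𝓡 n) (𝓡 n) k (f q)).comp (mfderiv (𝓡 n) (𝓡 n) f q) :=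
    mfderiv_comp q (k.mdifferentiable (by simp) _) (f.mdifferentiable (by simp) _)
  refine (cotangentLift_mk (f.trans k) q a).trans ?_
  rw [h]
  refine Eq.trans ?_ (congrArg (cotangentLift f) (cotangentLift_mk k (f q) a)).symm
  exact (cotangentLift_mk f q (ContinuousLinearMap.comp (a : Model n →L[ℝ] ℝ)
    (mfderiv (𝓡 n) (𝓡 n) k (f q) : Model n →L[ℝ] Model n))).symm

variable (m : ℕ) (G : Type*) [TopologicalSpace G] [ChartedSpace (Model m) G] [Group G]

/-- The cotangent-lifted left action of `G` on `T*Q`: `g` acts by `T*Φ_{g⁻¹}`, where `Φ_g` is the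
diffeomorphism `q ↦ g • q`. -/
@[reducible]
def cotangentLiftAction (n : ℕ) (Q : Type*) [TopologicalSpace Q] [ChartedSpace (Model n) Q]
    [IsManifold (𝓡 n) ∞ Q] [MulAction G Q] [ContMDiffSMul (𝓡 m) (𝓡 n) ∞ G Q] :
    MulAction G (CotangentBundle n Q) where
  smul g α := cotangentLift (Diffeomorph.smul (𝓡 m) (𝓡 n) ∞ g⁻¹) α
  one_smul α := by
    have h : Diffeomorph.smul (𝓡 m) (𝓡 n) ∞ (1 : G)⁻¹ = Diffeomorph.refl (𝓡 n) Q ∞ := by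
      ext x
      change (1 : G)⁻¹ • x = x
      rw [inv_one, one_smul]
    change cotangentLift (Diffeomorph.smul (𝓡 m) (𝓡 n) ∞ (1 : G)⁻¹) α = α
    rw [h, cotangentLift_refl]
  mul_smul g k α := by
    have h : (Diffeomorph.smul (𝓡 m) (𝓡 n) ∞ (g * k)⁻¹ : Q ≃ₘ^∞⟮𝓡 n, 𝓡 n⟯ Q) =
        (Diffeomorph.smul (𝓡 m) (𝓡 n) ∞ g⁻¹).trans (Diffeomorph.smul (𝓡 m) (𝓡 n) ∞ k⁻¹) := by
      ext x
      change (g * k)⁻¹ • x = k⁻¹ • g⁻¹ • x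
      rw [mul_inv_rev, mul_smul]
    change cotangentLift (Diffeomorph.smul (𝓡 m) (𝓡 n) ∞ (g * k)⁻¹) α =
      cotangentLift (Diffeomorph.smul (𝓡 m) (𝓡 n) ∞ g⁻¹)
        (cotangentLift (Diffeomorph.smul (𝓡 m) (𝓡 n) ∞ k⁻¹) α)
    rw [h, cotangentLift_trans]

/-- The standard momentum map `J : T*Q → 𝔤*` of a cotangent-lifted action,
`⟨J(α_q), ξ⟩ = ⟨α_q, ξ_Q(q)⟩`. -/
def standardMomentumMap [MulAction G Q] (α : CotangentBundle n Q) :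
    GroupLieAlgebra (𝓡 m) G →L[ℝ] ℝ :=
  ContinuousLinearMap.comp (α.2 : TangentSpace (𝓡 n) α.1 →L[ℝ] ℝ)
    (mfderiv (𝓡 m) (𝓡 n) (fun g : G => g • α.1) 1 :
      TangentSpace (𝓡 m) (1 : G) →L[ℝ] TangentSpace (𝓡 n) α.1)

end Cotangent

end

/-!
A chart of `Q` turns `T*Q` locally into `ℝⁿ × ℝⁿ` with coordinates `(q, p)`: by
`snd_apply_eq_inner_momentumCoord` the pairing of covectors with vectors becomes the inner product,
and by `contMDiffAt_cotangentPoint` and `contMDiffAt_momentumCoord` these coordinates are smooth in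
both directions. The bracket of two functions is then the canonical bivector of `ℝⁿ × ℝⁿ` on the
differentials of their coordinate expressions (`poissonBracketIn_eq_canonicalBivector`).

The cotangent lift of a diffeomorphism becomes a map `(q, p) ↦ (φ(q), P(q, p))` with
`⟨P(q, p), Dφ(q) v⟩ = ⟨p, v⟩` (`inner_momentumCoord_cotangentLift`). Differentiating this identity
and using the symmetry of `D²φ` shows that such a map preserves the canonical bivector
(`canonicalBivector_fderiv_comp`). The resulting naturality of the bracket,
`poissonBracketIn_cotangentLift`, contains both the independence of the chart (the lift of the
identity) and the canonicity of the action (the lift of `q ↦ g⁻¹ • q`).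

For Hamilton's equations, let `c` be a path in `G` with `c(0) = 1` and `c'(0) = ξ`. In coordinates
`J_ξ(q, p) = ⟨p, X(q)⟩`, where `X` is the initial velocity of `k(t, x) = c(t) • x`
(`standardMomentumMap_cotangentPoint`), while the orbit `c(t) • α` has momentum `p(t)` with
`⟨p(t), D_x k(t, q) v⟩ = ⟨p(0), v⟩`. The derivative at `t = 0` gives `p'(0) = -∂J_ξ/∂q`, because the
derivatives of `k` in `t` and `x` commute; and `q'(0) = X(q) = ∂J_ξ/∂p`
(`canonicalBivector_fderiv_momentum`).
-/

noncomputable section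

/-! ### Derivatives depending on a parameter -/

section ParametricDerivative

variable {E : Type*} [NormedAddCommGroup E] [NormedSpace ℝ E] {H : Type*} [TopologicalSpace H]
  {I : ModelWithCorners ℝ E H} {M : Type*} [TopologicalSpace M] [ChartedSpace H M]
  [IsManifold I ∞ M]
  {E' : Type*} [NormedAddCommGroup E'] [NormedSpace ℝ E'] {H' : Type*} [TopologicalSpace H']
  {I' : ModelWithCorners ℝ E' H'} {M' : Type*} [TopologicalSpace M'] [ChartedSpace H' M']
  [IsManifold I' ∞ M']
  {F : Type*} [NormedAddCommGroup F] [NormedSpace ℝ F] {K : Type*} [TopologicalSpace K]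
  {J : ModelWithCorners ℝ F K} {N : Type*} [TopologicalSpace N] [ChartedSpace K N]
  [IsManifold J ∞ N]

/-- If `f x : M → M'` depends smoothly on the parameter `x` and `v` is a smooth family of tangent
vectors of `M`, then the image of `v x` under the derivative of `f x` is a smooth family of tangent
vectors of `M'`. -/
theorem ContMDiffAt.mfderiv_section {f : N → M → M'} {b : N → M}
    {v : (x : N) → TangentSpace I (b x)} {x₀ : N}
    (hf : ContMDiffAt (J.prod I) I' ∞ (Function.uncurry f) (x₀, b x₀))
    (hv : ContMDiffAt J I.tangent ∞ (fun x => (⟨b x, v x⟩ : TangentBundle I M)) x₀) :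
    ContMDiffAt J I'.tangent ∞
      (fun x => (⟨f x (b x), mfderiv I I' (f x) (b x) (v x)⟩ : TangentBundle I' M')) x₀ := by
  have hb : ContMDiffAt J I ∞ b x₀ := (contMDiffAt_totalSpace.1 hv).1
  have hfb : ContMDiffAt J I' ∞ (fun x => f x (b x)) x₀ :=
    ContMDiffAt.comp x₀ hf (contMDiffAt_id.prodMk hb)
  exact ContMDiffAt.clm_apply_of_inCoordinates (b₁ := b) (b₂ := fun x => f x (b x))
    (ϕ := fun x => mfderiv I I' (f x) (b x))
    (ContMDiffAt.mfderiv f b hf hb (by simp)) hv hfb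

end ParametricDerivative

/-! ### Cotangent-lifted coordinates -/

section LiftedCoordinates

variable {n : ℕ}
  {Q : Type*} [TopologicalSpace Q] [ChartedSpace (Model n) Q]
  {e : OpenPartialHomeomorph Q (Model n)}

theorem mdifferentiableAt_chart (he : e ∈ IsManifold.maximalAtlas (𝓡 n) ∞ Q) {x : Q}
    (hx : x ∈ e.source) : MDifferentiableAt (𝓡 n) (𝓡 n) e x :=
  ((contMDiffOn_of_mem_maximalAtlas he).contMDiffAt (e.open_source.mem_nhds hx)).mdifferentiableAt
    (by simp)

theorem mdifferentiableAt_chart_symm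
    (he : e ∈ IsManifold.maximalAtlas (𝓡 n) ∞ Q) {y : Model n} (hy : y ∈ e.target) :
    MDifferentiableAt (𝓡 n) (𝓡 n) e.symm y :=
  ((contMDiffOn_symm_of_mem_maximalAtlas he).contMDiffAt
    (e.open_target.mem_nhds hy)).mdifferentiableAt (by simp)

theorem mvfderiv_chart_mfderiv_symm (he : e ∈ IsManifold.maximalAtlas (𝓡 n) ∞ Q) {y : Model n}
    (hy : y ∈ e.target) (v : Model n) :
    mvfderiv (𝓡 n) e (e.symm y) (mfderiv (𝓡 n) (𝓡 n) e.symm y v) = v := by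
  have h1 := mfderiv_comp y (mdifferentiableAt_chart he (e.map_target hy))
    (mdifferentiableAt_chart_symm he hy)
  have h2 : mfderiv (𝓡 n) (𝓡 n) (e ∘ e.symm) y = mfderiv (𝓡 n) (𝓡 n) id y := by
    apply Filter.EventuallyEq.mfderiv_eq
    filter_upwards [e.open_target.mem_nhds hy] with z hz using e.right_inv hz
  rw [h2, mfderiv_id] at h1
  exact (DFunLike.congr_fun h1 v).symm

theorem mfderiv_symm_mvfderiv_chart (he : e ∈ IsManifold.maximalAtlas (𝓡 n) ∞ Q) {x : Q}
    (hx : x ∈ e.source) (v : TangentSpace (𝓡 n) x) :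
    (mfderiv (𝓡 n) (𝓡 n) e.symm (e x) : Model n →L[ℝ] TangentSpace (𝓡 n) x)
      (mvfderiv (𝓡 n) e x v) = v := by
  have h1 := mfderiv_comp x (mdifferentiableAt_chart_symm he (e.map_source hx))
    (mdifferentiableAt_chart he hx)
  have h2 : mfderiv (𝓡 n) (𝓡 n) (e.symm ∘ e) x = mfderiv (𝓡 n) (𝓡 n) id x := by
    apply Filter.EventuallyEq.mfderiv_eq
    filter_upwards [e.open_source.mem_nhds hx] with z hz using e.left_inv hz
  rw [h2, mfderiv_id] at h1
  exact (DFunLike.congr_fun h1 v).symm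

theorem coordForm_apply (he : e ∈ IsManifold.maximalAtlas (𝓡 n) ∞ Q) {x : Q}
    (hx : x ∈ e.source) (i : Fin n) (v : TangentSpace (𝓡 n) x) :
    coordForm e i x v = mvfderiv (𝓡 n) e x v i := by
  have h1 := mfderiv_comp (I'' := 𝓘(ℝ, ℝ)) x
    (g := (EuclideanSpace.proj i : Model n →L[ℝ] ℝ))
    (EuclideanSpace.proj i : Model n →L[ℝ] ℝ).mdifferentiableAt (mdifferentiableAt_chart he hx)
  rw [ContinuousLinearMap.mfderiv_eq] at h1
  exact DFunLike.congr_fun h1 v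

theorem sum_coordForm_apply (he : e ∈ IsManifold.maximalAtlas (𝓡 n) ∞ Q) {x : Q}
    (hx : x ∈ e.source) (p : Model n) (v : TangentSpace (𝓡 n) x) :
    (∑ i, p i • coordForm e i x) v = inner ℝ p (mvfderiv (𝓡 n) e x v) := by
  rw [sum_apply, PiLp.inner_apply]
  refine Finset.sum_congr rfl fun i _ => ?_
  rw [smul_apply, coordForm_apply he hx]
  simp [mul_comm]

variable [IsManifold (𝓡 n) ∞ Q]

theorem cotangentPoint_snd_apply (he : e ∈ IsManifold.maximalAtlas (𝓡 n) ∞ Q) {q : Model n}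
    (hq : q ∈ e.target) (p : Model n) (v : TangentSpace (𝓡 n) (e.symm q)) :
    (cotangentPoint e q p).2 v = inner ℝ p (mvfderiv (𝓡 n) e (e.symm q) v) :=
  sum_coordForm_apply he (e.map_target hq) p v

/-- Through a chart, the pairing of covectors with tangent vectors becomes the inner product of
`ℝⁿ`. -/
theorem snd_apply_eq_inner_momentumCoord (he : e ∈ IsManifold.maximalAtlas (𝓡 n) ∞ Q)
    {α : CotangentBundle n Q} (hα : α.1 ∈ e.source) (v : TangentSpace (𝓡 n) α.1) :
    α.2 v = inner ℝ (momentumCoord e α) (mvfderiv (𝓡 n) e α.1 v) := by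
  set w : Model n := mvfderiv (𝓡 n) e α.1 v
  let L : Model n →L[ℝ] ℝ := ContinuousLinearMap.comp (α.2 : Model n →L[ℝ] ℝ)
    (mfderiv (𝓡 n) (𝓡 n) e.symm (e α.1) : Model n →L[ℝ] Model n)
  have h1 : α.2 v = L w := congrArg α.2 (mfderiv_symm_mvfderiv_chart he hα v).symm
  have h2 : L w = ∑ i, w i * L (EuclideanSpace.single i 1) := by
    conv_lhs => rw [← (EuclideanSpace.basisFun (Fin n) ℝ).sum_repr w]
    rw [map_sum]
    simp
  rw [h1, h2, PiLp.inner_apply]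
  rfl

theorem cotangentPoint_momentumCoord (he : e ∈ IsManifold.maximalAtlas (𝓡 n) ∞ Q)
    {α : CotangentBundle n Q} (hα : α.1 ∈ e.source) :
    cotangentPoint e (e α.1) (momentumCoord e α) = α := by
  obtain ⟨x, a⟩ := α
  -- the base point `e.symm (e x)` is replaced by a variable, since it is only propositionally `x`
  have key : ∀ y : Q, y = x → (⟨y, ∑ i, momentumCoord e ⟨x, a⟩ i • coordForm e i y⟩ :
      CotangentBundle n Q) = ⟨x, a⟩ := by
    rintro y rfl
    refine congrArg (TotalSpace.mk y) (ContinuousLinearMap.ext fun v => ?_)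
    exact (sum_coordForm_apply he hα _ v).trans
      (snd_apply_eq_inner_momentumCoord he (α := ⟨y, a⟩) hα v).symm
  exact key _ (e.left_inv hα)

theorem contMDiffAt_coordVector (he : e ∈ IsManifold.maximalAtlas (𝓡 n) ∞ Q) (i : Fin n) {x : Q}
    (hx : x ∈ e.source) :
    ContMDiffAt (𝓡 n) (𝓡 n).tangent ∞
      (fun y => (⟨y, coordVector e i y⟩ : TangentBundle (𝓡 n) Q)) x := by
  have hs : ContMDiffAt (𝓡 n) (𝓡 n) ∞ e x :=
    (contMDiffOn_of_mem_maximalAtlas he).contMDiffAt (e.open_source.mem_nhds hx)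
  have ht : ContMDiffAt (𝓡 n) (𝓡 n) ∞ e.symm (e x) :=
    (contMDiffOn_symm_of_mem_maximalAtlas he).contMDiffAt
      (e.open_target.mem_nhds (e.map_source hx))
  have hsec : ContMDiff (𝓡 n) (𝓡 n).tangent ∞ (fun y : Model n =>
      (⟨y, EuclideanSpace.single i (1 : ℝ)⟩ : TangentBundle (𝓡 n) (Model n))) :=
    contMDiff_vectorSpace_iff_contDiff.2 contDiff_const
  have h := ContMDiffAt.mfderiv_section (J := 𝓡 n) (I := 𝓡 n) (I' := 𝓡 n)
    (f := fun _ : Q => e.symm) (b := e) (v := fun _ => EuclideanSpace.single i (1 : ℝ)) (x₀ := x)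
    (ContMDiffAt.comp (x, e x) ht contMDiffAt_snd) (hsec.contMDiffAt.comp x hs)
  refine h.congr_of_eventuallyEq ?_
  filter_upwards [e.open_source.mem_nhds hx] with y hy
  -- all tangent spaces are by definition `ℝⁿ`, so vectors over the equal points `e.symm (e y)` and
  -- `y` can be compared by `HEq.rfl`
  exact TotalSpace.ext (e.left_inv hy).symm HEq.rfl

theorem contMDiff_cotangentBundle_proj :
    ContMDiff (cotangentModel n) (𝓡 n) ∞ (fun α : CotangentBundle n Q => α.1) :=
  Bundle.contMDiff_proj _

/-- The pairing of a smooth family of covectors with a smooth family of tangent vectors over the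
same base points is smooth. -/
theorem ContMDiffAt.cotangentBundle_pairing {E : Type*} [NormedAddCommGroup E] [NormedSpace ℝ E]
    {H : Type*} [TopologicalSpace H] {J : ModelWithCorners ℝ E H} {N : Type*} [TopologicalSpace N]
    [ChartedSpace H N] {a : N → CotangentBundle n Q} {v : (x : N) → TangentSpace (𝓡 n) (a x).1}
    {x₀ : N} (ha : ContMDiffAt J (cotangentModel n) ∞ a x₀)
    (hv : ContMDiffAt J (𝓡 n).tangent ∞
      (fun x => (⟨(a x).1, v x⟩ : TangentBundle (𝓡 n) Q)) x₀) :
    ContMDiffAt J 𝓘(ℝ, ℝ) ∞ (fun x => (a x).2 (v x)) x₀ := by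
  have h := ContMDiffAt.clm_bundle_apply (b := fun x => (a x).1) (ϕ := fun x => (a x).2)
    (E₂ := Bundle.Trivial Q ℝ) (F₂ := ℝ) ha hv
  exact (contMDiffAt_totalSpace.1 h).2

theorem contMDiffAt_momentumCoord (he : e ∈ IsManifold.maximalAtlas (𝓡 n) ∞ Q)
    {α : CotangentBundle n Q} (hα : α.1 ∈ e.source) :
    ContMDiffAt (cotangentModel n) (𝓡 n) ∞ (momentumCoord e) α := by
  have h : ∀ i, ContMDiffAt (cotangentModel n) 𝓘(ℝ, ℝ) ∞
      (fun β : CotangentBundle n Q => β.2 (coordVector e i β.1)) α := fun i =>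
    ContMDiffAt.cotangentBundle_pairing contMDiffAt_id
      ((contMDiffAt_coordVector he i hα).comp α contMDiff_cotangentBundle_proj.contMDiffAt)
  exact (PiLp.continuousLinearEquiv 2 ℝ
    (fun _ : Fin n => ℝ)).symm.contDiff.contMDiff.contMDiffAt.comp α (contMDiffAt_pi_space.2 h)

theorem contMDiffAt_cotangentPoint (he : e ∈ IsManifold.maximalAtlas (𝓡 n) ∞ Q)
    {z : Model n × Model n} (hz : z.1 ∈ e.target) :
    ContMDiffAt 𝓘(ℝ, Model n × Model n) (cotangentModel n) ∞
      (fun y : Model n × Model n => (cotangentPoint e y.1 y.2 : CotangentBundle n Q)) z := by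
  have ht : ContMDiffAt (𝓡 n) (𝓡 n) ∞ e.symm z.1 :=
    (contMDiffOn_symm_of_mem_maximalAtlas he).contMDiffAt (e.open_target.mem_nhds hz)
  have hb : ContMDiffAt 𝓘(ℝ, Model n × Model n) (𝓡 n) ∞
      (fun y : Model n × Model n => e.symm y.1) z :=
    ContMDiffAt.comp z ht contDiff_fst.contMDiff.contMDiffAt
  rw [contMDiffAt_hom_bundle]
  refine ⟨hb, ?_⟩
  have hs : ContMDiffAt (𝓡 n) (𝓡 n) ∞ e (e.symm z.1) :=
    (contMDiffOn_of_mem_maximalAtlas he).contMDiffAt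
      (e.open_source.mem_nhds (e.map_target hz))
  -- `∑ pᵢ dqⁱ` is the differential of the function `⟨p, e⟩`, so its coordinate expression is
  -- a derivative with parameters
  have hf : ContMDiffAt (𝓘(ℝ, Model n × Model n).prod (𝓡 n)) 𝓘(ℝ, ℝ) ∞
      (Function.uncurry fun (y : Model n × Model n) (x : Q) => inner ℝ y.2 (e x))
      (z, e.symm z.1) := by
    have h1 : ContMDiffAt (𝓘(ℝ, Model n × Model n).prod (𝓡 n)) 𝓘(ℝ, Model n × Model n) ∞
        (fun w : (Model n × Model n) × Q => (w.1.2, e w.2)) (z, e.symm z.1) :=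
      ContMDiffAt.prodMk_space
        (contDiff_snd.contMDiff.contMDiffAt.comp (z, e.symm z.1) contMDiffAt_fst)
        (ContMDiffAt.comp (z, e.symm z.1) hs contMDiffAt_snd)
    exact (contDiff_inner (𝕜 := ℝ)).contMDiff.contMDiffAt.comp (z, e.symm z.1) h1
  have h := ContMDiffAt.mfderiv (m := ∞) _ _ hf hb (by simp)
  refine h.congr_of_eventuallyEq ?_
  filter_upwards [(e.open_target.preimage continuous_fst).mem_nhds hz] with y hy
  have key : ∀ w : TangentSpace (𝓡 n) (e.symm y.1), (cotangentPoint e y.1 y.2).2 w =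
      mfderiv (𝓡 n) 𝓘(ℝ, ℝ) (fun x => inner ℝ y.2 (e x)) (e.symm y.1) w := fun w => by
    have h1 := mfderiv_comp (I'' := 𝓘(ℝ, ℝ)) (e.symm y.1) (g := (innerSL ℝ y.2 : Model n →L[ℝ] ℝ))
      (innerSL ℝ y.2 : Model n →L[ℝ] ℝ).mdifferentiableAt
      (mdifferentiableAt_chart he (e.map_target hy))
    rw [ContinuousLinearMap.mfderiv_eq] at h1
    exact (cotangentPoint_snd_apply he hy y.2 w).trans (DFunLike.congr_fun h1 w).symm
  ext v
  simp only [inTangentCoordinates, ContinuousLinearMap.inCoordinates,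
    ContinuousLinearMap.comp_apply]
  exact (DFunLike.congr_fun (Bundle.Trivial.continuousLinearMapAt_trivialization ℝ Q ℝ _) _).trans
    ((key _).trans
      (DFunLike.congr_fun
        (TangentBundle.continuousLinearMapAt_model_space (𝕜 := ℝ) (F := ℝ) _ _) _).symm)

end LiftedCoordinates

/-! ### The canonical bracket of `ℝⁿ × ℝⁿ` -/

section Flat

variable {n : ℕ}

/-- The canonical Poisson bivector of `ℝⁿ × ℝⁿ`, with coordinates `(q, p)`, evaluated on two linear
forms: on the differentials of two functions it gives their classical Poisson bracket. -/
def canonicalBivector (f k : Model n × Model n →L[ℝ] ℝ) : ℝ :=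
  ∑ i, (f (EuclideanSpace.single i 1, 0) * k (0, EuclideanSpace.single i 1) -
    f (0, EuclideanSpace.single i 1) * k (EuclideanSpace.single i 1, 0))

/-- The vector of `ℝⁿ` that represents the restriction of a linear form on `ℝⁿ × ℝⁿ` to the momentum
directions; for the differential of `F` it is `(∂F/∂p₁, …, ∂F/∂pₙ)`. -/
def momentumGradient (f : Model n × Model n →L[ℝ] ℝ) : Model n :=
  (InnerProductSpace.toDual ℝ (Model n)).symm (f.comp (ContinuousLinearMap.inr ℝ _ _))

theorem inner_momentumGradient (f : Model n × Model n →L[ℝ] ℝ) (w : Model n) :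
    inner ℝ (momentumGradient f) w = f (0, w) :=
  InnerProductSpace.toDual_symm_apply

theorem momentumGradient_eq {f : Model n × Model n →L[ℝ] ℝ} {b : Model n}
    (h : ∀ w, f (0, w) = inner ℝ b w) : momentumGradient f = b :=
  ext_inner_right ℝ fun w => (inner_momentumGradient f w).trans (h w)

theorem sum_mul_eq_apply_momentumGradient (f k : Model n × Model n →L[ℝ] ℝ) :
    ∑ i, f (EuclideanSpace.single i 1, 0) * k (0, EuclideanSpace.single i 1) =
      f (momentumGradient k, 0) := by
  let L : Model n →L[ℝ] ℝ := f.comp (ContinuousLinearMap.inl ℝ _ _)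
  change ∑ i, L (EuclideanSpace.single i 1) * _ = L (momentumGradient k)
  conv_rhs => rw [← (EuclideanSpace.basisFun (Fin n) ℝ).sum_repr (momentumGradient k)]
  rw [map_sum]
  refine Finset.sum_congr rfl fun i _ => ?_
  rw [← inner_momentumGradient k]
  rw [EuclideanSpace.inner_single_right]
  simp [mul_comm]

/-- A basis-free form of the canonical bivector. -/
theorem canonicalBivector_eq (f k : Model n × Model n →L[ℝ] ℝ) :
    canonicalBivector f k = f (momentumGradient k, 0) - k (momentumGradient f, 0) := by
  rw [canonicalBivector, Finset.sum_sub_distrib, sum_mul_eq_apply_momentumGradient,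
    ← sum_mul_eq_apply_momentumGradient k f]
  simp only [mul_comm]

/-- The canonical bivector is preserved by the derivative `S` of a cotangent lift: the momentum part
`A` of `S` is the inverse transpose of the position part `L`, and `Lᵀ B` is symmetric, where `B` is
the mixed part. -/
theorem canonicalBivector_comp {S : Model n × Model n →L[ℝ] Model n × Model n}
    {L A B : Model n →L[ℝ] Model n} (hS : ∀ u w, S (u, w) = (L u, B u + A w))
    (hA : ∀ w v, inner ℝ (A w) (L v) = inner ℝ w v)
    (hB : ∀ u v, inner ℝ (B u) (L v) = inner ℝ (B v) (L u))
    (f k : Model n × Model n →L[ℝ] ℝ) :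
    canonicalBivector (f.comp S) (k.comp S) = canonicalBivector f k := by
  let At := ContinuousLinearMap.adjoint A
  have hgrad : ∀ g : Model n × Model n →L[ℝ] ℝ,
      momentumGradient (g.comp S) = At (momentumGradient g) := fun g =>
    momentumGradient_eq fun w => by
      rw [ContinuousLinearMap.adjoint_inner_left, inner_momentumGradient]
      simp [hS]
  have hAtL : (At : Model n →ₗ[ℝ] Model n) * (L : Model n →ₗ[ℝ] Model n) = 1 := by
    refine LinearMap.ext fun v => ext_inner_left ℝ fun w => ?_
    exact (ContinuousLinearMap.adjoint_inner_right A w (L v)).trans (hA w v)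
  -- in finite dimension the left inverse `Aᵀ` of `L` is also a right inverse
  have hLAt : ∀ v, L (At v) = v := fun v => LinearMap.congr_fun (mul_eq_one_comm.1 hAtL) v
  -- the second summand is symmetric in `g` and `h` by `hB`, so it drops out of the bracket
  have hf : ∀ g h : Model n × Model n →L[ℝ] ℝ, g (S (At (momentumGradient h), 0)) =
      g (momentumGradient h, 0) +
        inner ℝ (L (At (momentumGradient g))) (B (At (momentumGradient h))) := fun g h => by
    rw [hS, hLAt, hLAt, inner_momentumGradient, ← map_add]
    simp
  rw [canonicalBivector_eq, canonicalBivector_eq, hgrad, hgrad, ContinuousLinearMap.comp_apply,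
    ContinuousLinearMap.comp_apply, hf f k, hf k f, real_inner_comm, hB, real_inner_comm]
  ring

/-- A map `(q, p) ↦ (φ q, P (q, p))` such that the pairing of `P (q, p)` with `Dφ(q) v` is `⟨p, v⟩`,
that is, the cotangent lift of a local diffeomorphism of `ℝⁿ`, preserves the canonical bracket. -/
theorem canonicalBivector_fderiv_comp {φ : Model n → Model n} {P : Model n × Model n → Model n}
    {z : Model n × Model n} (hφ : ContDiffAt ℝ 2 φ z.1) (hP : DifferentiableAt ℝ P z)
    (hpair : ∀ᶠ y in nhds z, ∀ v, inner ℝ (P y) (fderiv ℝ φ y.1 v) = inner ℝ y.2 v)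
    {f k : Model n × Model n → ℝ} (hf : DifferentiableAt ℝ f (φ z.1, P z))
    (hk : DifferentiableAt ℝ k (φ z.1, P z)) :
    canonicalBivector (fderiv ℝ (fun y => f (φ y.1, P y)) z)
        (fderiv ℝ (fun y => k (φ y.1, P y)) z) =
      canonicalBivector (fderiv ℝ f (φ z.1, P z)) (fderiv ℝ k (φ z.1, P z)) := by
  have hφ1 : HasFDerivAt φ (fderiv ℝ φ z.1) z.1 :=
    (hφ.differentiableAt (by simp)).hasFDerivAt
  have hφ2 : HasFDerivAt (fderiv ℝ φ) (fderiv ℝ (fderiv ℝ φ) z.1) z.1 :=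
    ((hφ.fderiv_right (m := 1) (by norm_num)).differentiableAt (by simp)).hasFDerivAt
  have hT : HasFDerivAt (fun y : Model n × Model n => (φ y.1, P y))
      (((fderiv ℝ φ z.1).comp (ContinuousLinearMap.fst ℝ _ _)).prod (fderiv ℝ P z)) z :=
    (hφ1.comp z hasFDerivAt_fst).prodMk hP.hasFDerivAt
  -- the derivative of the pairing identity in the direction `(u, w)`
  have hD : ∀ u w v, inner ℝ (P z) (fderiv ℝ (fderiv ℝ φ) z.1 u v) +
      inner ℝ (fderiv ℝ P z (u, w)) (fderiv ℝ φ z.1 v) = inner ℝ w v := fun u w v => by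
    have h1 : HasFDerivAt (fun y : Model n × Model n => fderiv ℝ φ y.1 v) _ z :=
      (hφ2.comp z hasFDerivAt_fst).clm_apply (hasFDerivAt_const v z)
    have h2 := hP.hasFDerivAt.inner ℝ h1
    have h3 : HasFDerivAt (fun y : Model n × Model n => inner ℝ y.2 v) _ z :=
      (hasFDerivAt_snd (𝕜 := ℝ) (p := z)).inner ℝ (hasFDerivAt_const v z)
    have h4 := h2.unique (h3.congr_of_eventuallyEq (hpair.mono fun y hy => hy v))
    simpa using DFunLike.congr_fun h4 (u, w)
  have hsymm : ∀ u v, fderiv ℝ (fderiv ℝ φ) z.1 u v = fderiv ℝ (fderiv ℝ φ) z.1 v u :=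
    hφ.isSymmSndFDerivAt (by simp)
  have hcomp : ∀ g : Model n × Model n → ℝ, DifferentiableAt ℝ g (φ z.1, P z) →
      fderiv ℝ (fun y => g (φ y.1, P y)) z = (fderiv ℝ g (φ z.1, P z)).comp
        (((fderiv ℝ φ z.1).comp (ContinuousLinearMap.fst ℝ _ _)).prod (fderiv ℝ P z)) :=
    fun g hg => (hg.hasFDerivAt.comp z hT).fderiv
  rw [hcomp f hf, hcomp k hk]
  refine canonicalBivector_comp (L := fderiv ℝ φ z.1)
    (A := (fderiv ℝ P z).comp (ContinuousLinearMap.inr ℝ _ _))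
    (B := (fderiv ℝ P z).comp (ContinuousLinearMap.inl ℝ _ _)) (fun u w => ?_) (fun w v => ?_)
    (fun u v => ?_) _ _
  · rw [ContinuousLinearMap.comp_apply, ContinuousLinearMap.comp_apply, ← map_add]
    simp
  · simpa using hD 0 w v
  · have h1 := hD u 0 v
    have h2 := hD v 0 u
    rw [hsymm] at h1
    simp only [inner_zero_left] at h1 h2
    simp only [ContinuousLinearMap.comp_apply, ContinuousLinearMap.inl_apply]
    linarith

/-- Let `k (t, ·)` be a motion of `ℝⁿ` starting at the identity, with initial velocity field
`X x = ∂k/∂t (0, x)`, and let `p t` be the momentum transported along it from `(q, p 0)`, as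
expressed by `hpair`. Then bracketing with the function `⟨p, X(q)⟩` is differentiation along the
curve `(k (t, q), p t)` at `t = 0`. By the symmetry of the second derivative of `k`, `hpair` gives
`⟨p'(0), v⟩ = -⟨p 0, DX(q) v⟩`, which is Hamilton's equation for the momentum. -/
theorem canonicalBivector_fderiv_momentum {k : ℝ × Model n → Model n} {q p' : Model n}
    {p : ℝ → Model n} (hk : ContDiffAt ℝ 2 k (0, q)) (hp : HasDerivAt p p' 0)
    (hpair : ∀ᶠ t in nhds 0, ∀ v, inner ℝ (p t) (fderiv ℝ (fun x => k (t, x)) q v) =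
      inner ℝ (p 0) v) (hk0 : ∀ᶠ x in nhds q, k (0, x) = x)
    (f : Model n × Model n →L[ℝ] ℝ) :
    canonicalBivector f (fderiv ℝ (fun z : Model n × Model n =>
      inner ℝ z.2 (fderiv ℝ k (0, z.1) (1, 0))) (q, p 0)) =
    f (fderiv ℝ k (0, q) (1, 0), p') := by
  have hk1 : ∀ᶠ y in nhds ((0 : ℝ), q), DifferentiableAt ℝ k y := by
    filter_upwards [hk.eventually (by simp)] with y hy using hy.differentiableAt (by simp)
  have hk2 : HasFDerivAt (fderiv ℝ k) (fderiv ℝ (fderiv ℝ k) (0, q)) (0, q) :=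
    ((hk.fderiv_right (m := 1) (by norm_num)).differentiableAt (by simp)).hasFDerivAt
  have hsymm : ∀ u v, fderiv ℝ (fderiv ℝ k) (0, q) u v = fderiv ℝ (fderiv ℝ k) (0, q) v u :=
    hk.isSymmSndFDerivAt (by simp)
  have ht : HasDerivAt (fun t : ℝ => (t, q)) ((1 : ℝ), (0 : Model n)) 0 :=
    (hasDerivAt_id (0 : ℝ)).prodMk (hasDerivAt_const 0 q)
  -- the derivative of `hpair` at `t = 0`, with the second derivatives of `k` interchanged
  have hp' : ∀ v, inner ℝ (p 0) (fderiv ℝ (fderiv ℝ k) (0, q) (0, v) (1, 0)) +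
      inner ℝ p' v = 0 := fun v => by
    have hx : ∀ᶠ t in nhds (0 : ℝ), fderiv ℝ (fun x => k (t, x)) q v =
        fderiv ℝ k (t, q) (0, v) := by
      filter_upwards [ht.continuousAt.eventually hk1] with t hkt
      have h1 : HasFDerivAt (fun x : Model n => (t, x)) (ContinuousLinearMap.inr ℝ ℝ (Model n)) q :=
        hasFDerivAt_prodMk_right t q
      exact DFunLike.congr_fun (hkt.hasFDerivAt.comp q h1).fderiv v
    have h1 : HasDerivAt (fun t : ℝ => fderiv ℝ k (t, q) (0, v))
        (fderiv ℝ (fderiv ℝ k) (0, q) (1, 0) (0, v)) 0 := by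
      have h0 : HasDerivAt (fun t : ℝ => fderiv ℝ k (t, q))
          (fderiv ℝ (fderiv ℝ k) (0, q) (1, 0)) 0 :=
        HasFDerivAt.comp_hasDerivAt (0 : ℝ) hk2 ht
      exact (ContinuousLinearMap.apply ℝ (Model n)
        ((0 : ℝ), v)).hasFDerivAt.comp_hasDerivAt (0 : ℝ) h0
    have h2 := hp.inner ℝ h1
    have h3 : HasDerivAt (fun _ : ℝ => inner ℝ (p 0) v) 0 0 := hasDerivAt_const _ _
    have h4 := h2.unique (h3.congr_of_eventuallyEq (by
      filter_upwards [hx, hpair] with t h h' using by rw [← h, h']))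
    have h5 : fderiv ℝ k (0, q) (0, v) = v := by
      rw [← hx.self_of_nhds, Filter.EventuallyEq.fderiv_eq (f := id) hk0, fderiv_id]
      rfl
    rw [hsymm, h5] at h4
    exact h4
  have hJ : ∀ u w, fderiv ℝ (fun z : Model n × Model n =>
      inner ℝ z.2 (fderiv ℝ k (0, z.1) (1, 0))) (q, p 0) (u, w) =
      inner ℝ (p 0) (fderiv ℝ (fderiv ℝ k) (0, q) (0, u) (1, 0)) +
        inner ℝ w (fderiv ℝ k (0, q) (1, 0)) := fun u w => by
    have h1 : HasFDerivAt (fun z : Model n × Model n => ((0 : ℝ), z.1))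
        ((ContinuousLinearMap.inr ℝ ℝ (Model n)).comp (ContinuousLinearMap.fst ℝ _ _)) (q, p 0) :=
      (hasFDerivAt_prodMk_right (0 : ℝ) q).comp (q, p 0) hasFDerivAt_fst
    have h2 := (hasFDerivAt_snd (𝕜 := ℝ) (p := (q, p 0))).inner ℝ
      ((HasFDerivAt.comp (q, p 0) hk2 h1).clm_apply (hasFDerivAt_const ((1 : ℝ), (0 : Model n)) _))
    refine (DFunLike.congr_fun h2.fderiv (u, w)).trans ?_
    simp
  have hgrad : momentumGradient (fderiv ℝ (fun z : Model n × Model n =>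
      inner ℝ z.2 (fderiv ℝ k (0, z.1) (1, 0))) (q, p 0)) = fderiv ℝ k (0, q) (1, 0) :=
    momentumGradient_eq fun w => by
      rw [hJ, real_inner_comm _ w, ← Prod.zero_eq_mk, map_zero]
      simp
  have hq : fderiv ℝ (fun z : Model n × Model n =>
      inner ℝ z.2 (fderiv ℝ k (0, z.1) (1, 0))) (q, p 0) (momentumGradient f, 0) =
      - f (0, p') := by
    rw [← inner_momentumGradient f, hJ, real_inner_comm p', inner_zero_left]
    linarith [hp' (momentumGradient f)]
  rw [canonicalBivector_eq, hgrad, hq, sub_neg_eq_add, ← map_add]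
  simp

end Flat

/-! ### Naturality of the bracket under cotangent lifts -/

section CotangentLift

variable {n : ℕ}
  {Q : Type*} [TopologicalSpace Q] [ChartedSpace (Model n) Q] [IsManifold (𝓡 n) ∞ Q]
  {S : Type*} [TopologicalSpace S] [ChartedSpace (Model n) S] [IsManifold (𝓡 n) ∞ S]
  {e : OpenPartialHomeomorph S (Model n)} {e' : OpenPartialHomeomorph Q (Model n)}

theorem ContMDiffAt.differentiableAt_comp_cotangentPoint
    (he : e' ∈ IsManifold.maximalAtlas (𝓡 n) ∞ Q) {F : CotangentBundle n Q → ℝ}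
    {α : CotangentBundle n Q} (hα : α.1 ∈ e'.source)
    (hF : ContMDiffAt (cotangentModel n) 𝓘(ℝ, ℝ) ∞ F α) :
    DifferentiableAt ℝ (fun z : Model n × Model n => F (cotangentPoint e' z.1 z.2))
      (e' α.1, momentumCoord e' α) := by
  have hF' : ContMDiffAt (cotangentModel n) 𝓘(ℝ, ℝ) ∞ F
      (cotangentPoint e' (e' α.1) (momentumCoord e' α)) := by
    rwa [cotangentPoint_momentumCoord he hα]
  have h := ContMDiffAt.comp (e' α.1, momentumCoord e' α) hF'
    (contMDiffAt_cotangentPoint he (z := (e' α.1, momentumCoord e' α)) (e'.map_source hα))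
  exact h.contDiffAt.differentiableAt (by simp)

theorem poissonBracketIn_eq_canonicalBivector
    (he : e' ∈ IsManifold.maximalAtlas (𝓡 n) ∞ Q) {F K : CotangentBundle n Q → ℝ}
    {α : CotangentBundle n Q} (hα : α.1 ∈ e'.source)
    (hF : ContMDiffAt (cotangentModel n) 𝓘(ℝ, ℝ) ∞ F α)
    (hK : ContMDiffAt (cotangentModel n) 𝓘(ℝ, ℝ) ∞ K α) :
    poissonBracketIn e' F K α = canonicalBivector
      (fderiv ℝ (fun z : Model n × Model n => F (cotangentPoint e' z.1 z.2))
        (e' α.1, momentumCoord e' α))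
      (fderiv ℝ (fun z : Model n × Model n => K (cotangentPoint e' z.1 z.2))
        (e' α.1, momentumCoord e' α)) := by
  have hq : ∀ {H : CotangentBundle n Q → ℝ}, ContMDiffAt (cotangentModel n) 𝓘(ℝ, ℝ) ∞ H α →
      ∀ i, partialQ e' i H α =
        fderiv ℝ (fun z : Model n × Model n => H (cotangentPoint e' z.1 z.2))
          (e' α.1, momentumCoord e' α) (EuclideanSpace.single i 1, 0) := fun {H} hH i => by
    rw [← (hH.differentiableAt_comp_cotangentPoint he hα).lineDeriv_eq_fderiv]
    simp [partialQ, lineDeriv]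
  have hp : ∀ {H : CotangentBundle n Q → ℝ}, ContMDiffAt (cotangentModel n) 𝓘(ℝ, ℝ) ∞ H α →
      ∀ i, partialP e' i H α =
        fderiv ℝ (fun z : Model n × Model n => H (cotangentPoint e' z.1 z.2))
          (e' α.1, momentumCoord e' α) (0, EuclideanSpace.single i 1) := fun {H} hH i => by
    rw [← (hH.differentiableAt_comp_cotangentPoint he hα).lineDeriv_eq_fderiv]
    simp [partialP, lineDeriv]
  simp only [poissonBracketIn, canonicalBivector, hq hF, hq hK, hp hF, hp hK]

/-- The cotangent lifts of a smooth family of diffeomorphisms, applied to a smooth family of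
covectors, form a smooth family of covectors. -/
theorem ContMDiffAt.cotangentLift_family {E : Type*} [NormedAddCommGroup E] [NormedSpace ℝ E]
    {H : Type*} [TopologicalSpace H] {J : ModelWithCorners ℝ E H} {N : Type*} [TopologicalSpace N]
    [ChartedSpace H N] [IsManifold J ∞ N] {f : N → Q ≃ₘ^∞⟮𝓡 n, 𝓡 n⟯ S} {a : N → CotangentBundle n S}
    {x₀ : N} (ha : ContMDiffAt J (cotangentModel n) ∞ a x₀)
    (hf : ContMDiff (J.prod (𝓡 n)) (𝓡 n) ∞ (fun y : N × Q => f y.1 y.2))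
    (hb : ContMDiffAt J (𝓡 n) ∞ (fun x => (f x).symm (a x).1) x₀) :
    ContMDiffAt J (cotangentModel n) ∞ (fun x => cotangentLift (f x) (a x)) x₀ := by
  let b : N → Q := fun x => (f x).symm (a x).1
  let e := chartAt (Model n) (b x₀)
  have he : e ∈ IsManifold.maximalAtlas (𝓡 n) ∞ Q := IsManifold.chart_mem_maximalAtlas _
  have hx₀ : b x₀ ∈ e.source := mem_chart_source (Model n) (b x₀)
  have hbe : ContMDiffAt J (𝓡 n) ∞ (fun x => e (b x)) x₀ :=
    ((contMDiffOn_of_mem_maximalAtlas he).contMDiffAt (e.open_source.mem_nhds hx₀)).comp x₀ hb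
  have hp : ContMDiffAt J (𝓡 n) ∞ (fun x => momentumCoord e (cotangentLift (f x) (a x))) x₀ := by
    have h : ∀ i, ContMDiffAt J 𝓘(ℝ, ℝ) ∞ (fun x => (a x).2
        (mfderiv (𝓡 n) (𝓡 n) (f x) (b x) (coordVector e i (b x)))) x₀ := fun i => by
      refine ha.cotangentBundle_pairing ?_
      refine (ContMDiffAt.mfderiv_section (f := fun x => f x) hf.contMDiffAt
        ((contMDiffAt_coordVector he i hx₀).comp x₀ hb)).congr_of_eventuallyEq ?_
      exact Filter.Eventually.of_forall fun x =>
        TotalSpace.ext ((f x).apply_symm_apply (a x).1).symm HEq.rfl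
    exact (PiLp.continuousLinearEquiv 2 ℝ
      (fun _ : Fin n => ℝ)).symm.contDiff.contMDiff.contMDiffAt.comp x₀ (contMDiffAt_pi_space.2 h)
  have h := ContMDiffAt.comp x₀ (contMDiffAt_cotangentPoint he
    (z := (e (b x₀), momentumCoord e (cotangentLift (f x₀) (a x₀)))) (e.map_source hx₀))
    (hbe.prodMk_space hp)
  refine h.congr_of_eventuallyEq ?_
  filter_upwards [hb.continuousAt.eventually (e.open_source.mem_nhds hx₀)] with x hx
  exact (cotangentPoint_momentumCoord he (α := cotangentLift (f x) (a x)) hx).symm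

/-- In cotangent-lifted coordinates, the cotangent lift of `f` acts on momenta by the inverse
transpose of the derivative of `f⁻¹`. -/
theorem inner_momentumCoord_cotangentLift (he : e ∈ IsManifold.maximalAtlas (𝓡 n) ∞ S)
    (he' : e' ∈ IsManifold.maximalAtlas (𝓡 n) ∞ Q) (f : Q ≃ₘ^∞⟮𝓡 n, 𝓡 n⟯ S) {q : Model n}
    (hq : q ∈ e.target) (hq' : f.symm (e.symm q) ∈ e'.source) (p v : Model n) :
    inner ℝ (momentumCoord e' (cotangentLift f (cotangentPoint e q p)))
      (fderiv ℝ (fun x => e' (f.symm (e.symm x))) q v) = inner ℝ p v := by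
  let w : TangentSpace (𝓡 n) (e.symm q) := mfderiv (𝓡 n) (𝓡 n) e.symm q v
  let u : TangentSpace (𝓡 n) (f.symm (e.symm q)) := mfderiv (𝓡 n) (𝓡 n) f.symm (e.symm q) w
  have hs := mdifferentiableAt_chart_symm he hq
  have hfs : MDifferentiableAt (𝓡 n) (𝓡 n) f.symm (e.symm q) := f.symm.mdifferentiable (by simp) _
  have h1 : fderiv ℝ (fun x => e' (f.symm (e.symm x))) q v =
      mvfderiv (𝓡 n) e' (f.symm (e.symm q)) u := by
    have h2 := (mdifferentiableAt_chart he' hq').hasMFDerivAt.comp q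
      (hfs.hasMFDerivAt.comp q hs.hasMFDerivAt)
    rw [← mfderiv_eq_fderiv]
    exact DFunLike.congr_fun h2.mfderiv v
  have h2 : (mfderiv (𝓡 n) (𝓡 n) f (f.symm (e.symm q)) u : Model n) = w := by
    have h3 := mfderiv_comp (e.symm q) (f.mdifferentiable (by simp) (f.symm (e.symm q))) hfs
    have h4 : (f : Q → S) ∘ f.symm = id := funext f.apply_symm_apply
    rw [h4, mfderiv_id] at h3
    exact (DFunLike.congr_fun h3 w).symm
  have h3 := snd_apply_eq_inner_momentumCoord he'
    (α := cotangentLift f (cotangentPoint e q p)) hq' u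
  have h4 := cotangentPoint_snd_apply he hq p w
  rw [mvfderiv_chart_mfderiv_symm he hq] at h4
  rw [h1]
  exact h3.symm.trans ((congrArg (cotangentPoint e q p).2 h2).trans h4)

/-- Cotangent lifts preserve the coordinate expression of the bracket, whatever charts are used at
the two base points. The identity of `Q` gives the independence of the chart, and the
diffeomorphisms of a group action show that the lifted action is canonical. -/
theorem poissonBracketIn_cotangentLift (he : e ∈ IsManifold.maximalAtlas (𝓡 n) ∞ S)
    (he' : e' ∈ IsManifold.maximalAtlas (𝓡 n) ∞ Q) (f : Q ≃ₘ^∞⟮𝓡 n, 𝓡 n⟯ S)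
    {F K : CotangentBundle n Q → ℝ} {α : CotangentBundle n S} (hα : α.1 ∈ e.source)
    (hα' : f.symm α.1 ∈ e'.source)
    (hF : ContMDiffAt (cotangentModel n) 𝓘(ℝ, ℝ) ∞ F (cotangentLift f α))
    (hK : ContMDiffAt (cotangentModel n) 𝓘(ℝ, ℝ) ∞ K (cotangentLift f α)) :
    poissonBracketIn e (fun β => F (cotangentLift f β)) (fun β => K (cotangentLift f β)) α =
      poissonBracketIn e' F K (cotangentLift f α) := by
  have hf : ContMDiffAt (cotangentModel n) (cotangentModel n) ∞ (cotangentLift f) α :=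
    ContMDiffAt.cotangentLift_family (f := fun _ => f) contMDiffAt_id
      (f.contMDiff.comp contMDiff_snd)
      (f.symm.contMDiff.contMDiffAt.comp α contMDiff_cotangentBundle_proj.contMDiffAt)
  refine (poissonBracketIn_eq_canonicalBivector he hα (ContMDiffAt.comp α hF hf)
    (ContMDiffAt.comp α hK hf)).trans
    (Eq.trans ?_ (poissonBracketIn_eq_canonicalBivector he' hα' hF hK).symm)
  have hα0 := cotangentPoint_momentumCoord he hα
  let φ : Model n → Model n := fun x => e' (f.symm (e.symm x))
  let P : Model n × Model n → Model n :=
    fun z => momentumCoord e' (cotangentLift f (cotangentPoint e z.1 z.2))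
  let z : Model n × Model n := (e α.1, momentumCoord e α)
  have hz : z.1 ∈ e.target := e.map_source hα
  have hes : e.symm z.1 = α.1 := e.left_inv hα
  have hφz : φ z.1 = e' (cotangentLift f α).1 := by
    change e' (f.symm (e.symm z.1)) = _
    rw [hes]
    rfl
  have hPz : P z = momentumCoord e' (cotangentLift f α) := by
    change momentumCoord e' (cotangentLift f (cotangentPoint e (e α.1) (momentumCoord e α))) = _
    rw [hα0]
  have hbase : ContMDiffAt (𝓡 n) (𝓡 n) ∞ (fun x => f.symm (e.symm x)) z.1 :=
    f.symm.contMDiff.contMDiffAt.comp _ ((contMDiffOn_symm_of_mem_maximalAtlas he).contMDiffAt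
      (e.open_target.mem_nhds hz))
  have hz' : f.symm (e.symm z.1) ∈ e'.source := by rwa [hes]
  have hφ : ContDiffAt ℝ 2 φ z.1 := by
    have h : ContMDiffAt (𝓡 n) (𝓡 n) ∞ φ z.1 := ContMDiffAt.comp z.1
      ((contMDiffOn_of_mem_maximalAtlas he').contMDiffAt (e'.open_source.mem_nhds hz')) hbase
    exact h.contDiffAt.of_le ENat.LEInfty.out
  have hP : DifferentiableAt ℝ P z := by
    have h1 : ContMDiffAt 𝓘(ℝ, Model n × Model n) (cotangentModel n) ∞
        (fun y : Model n × Model n => cotangentLift f (cotangentPoint e y.1 y.2)) z := by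
      refine ContMDiffAt.comp z (g := cotangentLift f) ?_ (contMDiffAt_cotangentPoint he hz)
      rwa [hα0]
    have h2 : ContMDiffAt 𝓘(ℝ, Model n × Model n) (𝓡 n) ∞ P z :=
      ContMDiffAt.comp z (contMDiffAt_momentumCoord he' hz') h1
    exact h2.contDiffAt.differentiableAt (by simp)
  have hpair : ∀ᶠ y in nhds z, ∀ v, inner ℝ (P y) (fderiv ℝ φ y.1 v) = inner ℝ y.2 v := by
    have h1 : ∀ᶠ x in nhds z.1, x ∈ e.target ∧ f.symm (e.symm x) ∈ e'.source :=
      Filter.Eventually.and (e.open_target.mem_nhds hz)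
        (hbase.continuousAt.eventually (e'.open_source.mem_nhds hz'))
    filter_upwards [continuous_fst.continuousAt.eventually h1] with y hy v
    exact inner_momentumCoord_cotangentLift he he' f hy.1 hy.2 y.2 v
  have hF' := hF.differentiableAt_comp_cotangentPoint he' hα'
  have hK' := hK.differentiableAt_comp_cotangentPoint he' hα'
  rw [← hφz, ← hPz] at hF' hK' ⊢
  rw [← canonicalBivector_fderiv_comp hφ hP hpair hF' hK']
  have hcomp : ∀ H : CotangentBundle n Q → ℝ,
      (fun y : Model n × Model n => H (cotangentLift f (cotangentPoint e y.1 y.2))) =ᶠ[nhds z]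
        fun y => H (cotangentPoint e' (φ y.1) (P y)) := fun H => by
    filter_upwards [continuous_fst.continuousAt.eventually
      (hbase.continuousAt.eventually (e'.open_source.mem_nhds hz'))] with y hy
    exact congrArg H (cotangentPoint_momentumCoord he'
      (α := cotangentLift f (cotangentPoint e y.1 y.2)) hy).symm
  exact congrArg₂ canonicalBivector (hcomp F).fderiv_eq (hcomp K).fderiv_eq

theorem classicalBracket_eq_poissonBracketIn
    (he : e' ∈ IsManifold.maximalAtlas (𝓡 n) ∞ Q) {F K : CotangentBundle n Q → ℝ}
    (hF : ContMDiff (cotangentModel n) 𝓘(ℝ, ℝ) ∞ F)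
    (hK : ContMDiff (cotangentModel n) 𝓘(ℝ, ℝ) ∞ K)
    {α : CotangentBundle n Q} (hα : α.1 ∈ e'.source) :
    classicalBracket F K α = poissonBracketIn e' F K α := by
  have h := poissonBracketIn_cotangentLift
    (IsManifold.chart_mem_maximalAtlas (I := 𝓡 n) (n := ∞) α.1) he (Diffeomorph.refl (𝓡 n) Q ∞)
    (mem_chart_source (Model n) α.1) hα (hF _) (hK _)
  simp only [cotangentLift_refl] at h
  exact h

end CotangentLift

/-! ### Infinitesimal generators as velocities -/

section Velocity

variable {EP : Type*} [NormedAddCommGroup EP] [NormedSpace ℝ EP]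
  {HP : Type*} [TopologicalSpace HP] {IP : ModelWithCorners ℝ EP HP}
  {P : Type*} [TopologicalSpace P] [ChartedSpace HP P]
  {W : Type*} [NormedAddCommGroup W] [NormedSpace ℝ W]
  {m : ℕ} {G : Type*} [TopologicalSpace G] [ChartedSpace (Model m) G] [Group G]

theorem mdifferentiableAt_smul_right [MulAction G P] [ContMDiffSMul (𝓡 m) IP ∞ G P]
    (x : P) (g : G) :
    MDifferentiableAt (𝓡 m) IP (fun g : G => g • x) g := by
  have h : ContMDiff (𝓡 m) IP ∞ (fun g : G => g • x) := contMDiff_id.smul contMDiff_const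
  exact h.mdifferentiable (by simp) g

/-- The derivative of a function along `ξ_P` is its derivative along `t ↦ c(t) • x`, for any path
`c` with `c(0) = 1` and `c'(0) = ξ`. -/
theorem mvfderiv_infinitesimalGenerator [MulAction G P] {ξ : GroupLieAlgebra (𝓡 m) G} {x : P}
    {h : P → W} (hh : MDifferentiableAt IP 𝓘(ℝ, W) h x)
    (hx : MDifferentiableAt (𝓡 m) IP (fun g : G => g • x) 1) {c : ℝ → G}
    (hc : MDifferentiableAt 𝓘(ℝ, ℝ) (𝓡 m) c 0)
    (hξ : tangentMap 𝓘(ℝ, ℝ) (𝓡 m) c ⟨0, (1 : ℝ)⟩ = ⟨1, ξ⟩) :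
    mvfderiv IP h x (infinitesimalGenerator IP ξ x) = deriv (fun t => h (c t • x)) 0 := by
  have h0 : c 0 = 1 := congrArg TotalSpace.proj hξ
  have hx' : MDifferentiableAt (𝓡 m) IP (fun g : G => g • x) (c 0) := by rwa [h0]
  have hcx : MDifferentiableAt 𝓘(ℝ, ℝ) IP (fun t => c t • x) 0 := hx'.comp 0 hc
  have hh' : MDifferentiableAt IP 𝓘(ℝ, W) h (c 0 • x) := by rwa [h0, one_smul]
  have h1 := tangentMap_comp_at (I := 𝓘(ℝ, ℝ)) (I' := IP) (I'' := 𝓘(ℝ, W))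
    (f := fun t => c t • x) (g := h) ⟨(0 : ℝ), (1 : ℝ)⟩ hh' hcx
  rw [tangentMap_path_smul IP ξ x hx c hc hξ] at h1
  have h2 := congrArg (fun z : TangentBundle 𝓘(ℝ, W) W => (z.2 : W)) h1
  refine h2.symm.trans ?_
  rw [← fderiv_apply_one_eq_deriv, ← mfderiv_eq_fderiv]
  rfl

theorem exists_contMDiffAt_path [IsManifold (𝓡 m) ∞ G] (ξ : GroupLieAlgebra (𝓡 m) G) :
    ∃ c : ℝ → G, ContMDiffAt 𝓘(ℝ, ℝ) (𝓡 m) ∞ c 0 ∧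
      tangentMap 𝓘(ℝ, ℝ) (𝓡 m) c ⟨0, (1 : ℝ)⟩ = ⟨1, ξ⟩ := by
  let e := chartAt (Model m) (1 : G)
  have he : e ∈ IsManifold.maximalAtlas (𝓡 m) ∞ G := IsManifold.chart_mem_maximalAtlas _
  have h1 : (1 : G) ∈ e.source := mem_chart_source (Model m) (1 : G)
  let η : Model m := mvfderiv (𝓡 m) e 1 ξ
  let l : ℝ → Model m := fun t => e 1 + t • η
  have hl0 : l 0 = e 1 := by simp [l]
  have hl : HasDerivAt l η 0 := by
    have h := ((hasDerivAt_id (0 : ℝ)).smul_const η).const_add (e 1)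
    rwa [one_smul] at h
  have hls : ContDiff ℝ ∞ l := contDiff_const.add (contDiff_id.smul contDiff_const)
  have hs : ContMDiffAt (𝓡 m) (𝓡 m) ∞ e.symm (l 0) := by
    rw [hl0]
    exact (contMDiffOn_symm_of_mem_maximalAtlas he).contMDiffAt
      (e.open_target.mem_nhds (e.map_source h1))
  refine ⟨fun t => e.symm (l t), hs.comp 0 hls.contMDiff.contMDiffAt, ?_⟩
  have h2 := tangentMap_comp_at (I := 𝓘(ℝ, ℝ)) (I' := 𝓡 m) (I'' := 𝓡 m) (f := l) (g := e.symm)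
    ⟨(0 : ℝ), (1 : ℝ)⟩ (hs.mdifferentiableAt (by simp)) hl.differentiableAt.mdifferentiableAt
  have h3 : tangentMap 𝓘(ℝ, ℝ) (𝓡 m) l ⟨0, (1 : ℝ)⟩ = ⟨e 1, η⟩ := by
    refine TotalSpace.ext hl0 (heq_of_eq ?_)
    have h4 : (mfderiv 𝓘(ℝ, ℝ) (𝓡 m) l 0 : ℝ →L[ℝ] Model m) 1 = η := by
      rw [mfderiv_eq_fderiv]
      exact (fderiv_apply_one_eq_deriv).trans hl.deriv
    exact h4
  rw [h3] at h2
  refine h2.trans (TotalSpace.ext (e.left_inv h1) (heq_of_eq ?_))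
  exact mfderiv_symm_mvfderiv_chart he h1 ξ

end Velocity

/-! ### Lifted actions and the momentum map -/

section Action

variable {m n : ℕ} {G : Type*} [Group G] {Q : Type*} [TopologicalSpace Q] [MulAction G Q]

/-- The motion of `Q` along a path `c` in `G`, read in the chart `e`:
`(t, x) ↦ e(c(t) • e⁻¹(x))`. -/
def motionInChart (e : OpenPartialHomeomorph Q (Model n)) (c : ℝ → G) (y : ℝ × Model n) : Model n :=
  e (c y.1 • e.symm y.2)

theorem motionInChart_zero {e : OpenPartialHomeomorph Q (Model n)} {c : ℝ → G} (hc0 : c 0 = 1)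
    {x : Model n} (hx : x ∈ e.target) : motionInChart e c (0, x) = x := by
  rw [motionInChart, hc0, one_smul, e.right_inv hx]

variable [TopologicalSpace G] [ChartedSpace (Model m) G] [ChartedSpace (Model n) Q]
  [ContMDiffSMul (𝓡 m) (𝓡 n) ∞ G Q]

theorem Diffeomorph.smul_inv_symm_apply (g : G) (q : Q) :
    (Diffeomorph.smul (𝓡 m) (𝓡 n) ∞ g⁻¹ : Q ≃ₘ^∞⟮𝓡 n, 𝓡 n⟯ Q).symm q = g • q := by
  rw [Diffeomorph.smul_symm_apply, inv_inv]

theorem contDiffAt_motionInChart {e : OpenPartialHomeomorph Q (Model n)}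
    (he : e ∈ IsManifold.maximalAtlas (𝓡 n) ∞ Q) {c : ℝ → G}
    (hc : ContMDiffAt 𝓘(ℝ, ℝ) (𝓡 m) ∞ c 0) (hc0 : c 0 = 1) {x : Model n} (hx : x ∈ e.target) :
    ContDiffAt ℝ ∞ (motionInChart e c) (0, x) := by
  have hbase : ContMDiffAt 𝓘(ℝ, ℝ × Model n) (𝓡 n) ∞
      (fun y : ℝ × Model n => c y.1 • e.symm y.2) (0, x) :=
    (ContMDiffAt.comp (0, x) hc contDiff_fst.contMDiff.contMDiffAt).smul
      (ContMDiffAt.comp (0, x) ((contMDiffOn_symm_of_mem_maximalAtlas he).contMDiffAt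
        (e.open_target.mem_nhds hx)) contDiff_snd.contMDiff.contMDiffAt)
  have hbase0 : c 0 • e.symm x ∈ e.source := by
    rw [hc0, one_smul]
    exact e.map_target hx
  have hk : ContMDiffAt 𝓘(ℝ, ℝ × Model n) (𝓡 n) ∞ (motionInChart e c) (0, x) :=
    ContMDiffAt.comp (0, x) ((contMDiffOn_of_mem_maximalAtlas he).contMDiffAt
      (e.open_source.mem_nhds hbase0)) hbase
  exact hk.contDiffAt

theorem hasDerivAt_motionInChart {e : OpenPartialHomeomorph Q (Model n)}
    (he : e ∈ IsManifold.maximalAtlas (𝓡 n) ∞ Q) {c : ℝ → G}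
    (hc : ContMDiffAt 𝓘(ℝ, ℝ) (𝓡 m) ∞ c 0) (hc0 : c 0 = 1) {x : Model n} (hx : x ∈ e.target) :
    HasDerivAt (fun t => motionInChart e c (t, x)) (fderiv ℝ (motionInChart e c) (0, x) (1, 0)) 0 :=
  HasFDerivAt.comp_hasDerivAt (0 : ℝ) (f := fun t : ℝ => (t, x))
    ((contDiffAt_motionInChart he hc hc0 hx).differentiableAt (by simp)).hasFDerivAt
    ((hasDerivAt_id (0 : ℝ)).prodMk (hasDerivAt_const 0 x))

variable [IsManifold (𝓡 n) ∞ Q]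

/-- In cotangent-lifted coordinates `J_ξ(q, p) = ⟨p, X(q)⟩`, where `X` is the initial velocity of
the motion of `Q` along a path with velocity `ξ`. -/
theorem standardMomentumMap_cotangentPoint {e : OpenPartialHomeomorph Q (Model n)}
    (he : e ∈ IsManifold.maximalAtlas (𝓡 n) ∞ Q) {ξ : GroupLieAlgebra (𝓡 m) G} {c : ℝ → G}
    (hc : ContMDiffAt 𝓘(ℝ, ℝ) (𝓡 m) ∞ c 0)
    (hξ : tangentMap 𝓘(ℝ, ℝ) (𝓡 m) c ⟨0, (1 : ℝ)⟩ = ⟨1, ξ⟩) {q : Model n} (hq : q ∈ e.target)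
    (p : Model n) :
    standardMomentumMap m G (cotangentPoint e q p : CotangentBundle n Q) ξ =
      inner ℝ p (fderiv ℝ (motionInChart e c) (0, q) (1, 0)) := by
  have h1 := mvfderiv_infinitesimalGenerator (mdifferentiableAt_chart he (e.map_target hq))
    (mdifferentiableAt_smul_right _ _) (hc.mdifferentiableAt (by simp)) hξ
  have h2 := (hasDerivAt_motionInChart he hc (congrArg TotalSpace.proj hξ) hq).deriv
  exact (cotangentPoint_snd_apply he hq p _).trans (congrArg (inner ℝ p) (h1.trans h2))

variable (m n G Q) in
theorem isCanonicalAction_cotangentLiftAction :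
    letI : MulAction G (CotangentBundle n Q) := cotangentLiftAction m G n Q
    IsCanonicalAction (cotangentModel n) (classicalBracket (n := n) (Q := Q)) G := by
  intro g F K hF hK α
  let f : Q ≃ₘ^∞⟮𝓡 n, 𝓡 n⟯ Q := Diffeomorph.smul (𝓡 m) (𝓡 n) ∞ g⁻¹
  change poissonBracketIn (chartAt (Model n) α.1) (fun β => F (cotangentLift f β))
    (fun β => K (cotangentLift f β)) α =
      poissonBracketIn (chartAt (Model n) (f.symm α.1)) F K (cotangentLift f α)
  exact poissonBracketIn_cotangentLift (IsManifold.chart_mem_maximalAtlas (I := 𝓡 n) (n := ∞) α.1)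
    (IsManifold.chart_mem_maximalAtlas (I := 𝓡 n) (n := ∞) (f.symm α.1)) f
    (mem_chart_source (Model n) α.1) (mem_chart_source (Model n) (f.symm α.1)) (hF _) (hK _)

variable [LieGroup (𝓡 m) ∞ G]

variable (m n G Q) in
theorem contMDiffSMul_cotangentLiftAction :
    letI : MulAction G (CotangentBundle n Q) := cotangentLiftAction m G n Q
    ContMDiffSMul (𝓡 m) (cotangentModel n) ∞ G (CotangentBundle n Q) := by
  let _ : MulAction G (CotangentBundle n Q) := cotangentLiftAction m G n Q
  refine ⟨fun y => ?_⟩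
  have hinv : ContMDiff (((𝓡 m).prod (cotangentModel n)).prod (𝓡 n)) (𝓡 m) ∞
      (fun w : (G × CotangentBundle n Q) × Q => w.1.1⁻¹) :=
    (contMDiff_fst.comp contMDiff_fst).inv
  refine ContMDiffAt.cotangentLift_family
    (f := fun y : G × CotangentBundle n Q => Diffeomorph.smul (𝓡 m) (𝓡 n) ∞ y.1⁻¹) (a := Prod.snd)
    contMDiffAt_snd (hinv.smul contMDiff_snd) ?_
  have hb : ContMDiff ((𝓡 m).prod (cotangentModel n)) (𝓡 n) ∞
      (fun y : G × CotangentBundle n Q => y.1 • y.2.1) :=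
    contMDiff_fst.smul (contMDiff_cotangentBundle_proj.comp contMDiff_snd)
  refine hb.contMDiffAt.congr_of_eventuallyEq (Filter.Eventually.of_forall fun y => ?_)
  exact Diffeomorph.smul_inv_symm_apply y.1 y.2.1

theorem contMDiff_infinitesimalGenerator (ξ : GroupLieAlgebra (𝓡 m) G) :
    ContMDiff (𝓡 n) (𝓡 n).tangent ∞
      (fun q : Q => (⟨q, infinitesimalGenerator (𝓡 n) ξ q⟩ : TangentBundle (𝓡 n) Q)) := fun q => by
  have h : ContMDiff ((𝓡 n).prod (𝓡 m)) (𝓡 n) ∞ (fun y : Q × G => y.2 • y.1) :=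
    contMDiff_snd.smul contMDiff_fst
  refine (ContMDiffAt.mfderiv_section (J := 𝓡 n) (I := 𝓡 m) (I' := 𝓡 n)
    (f := fun (x : Q) (g : G) => g • x) (b := fun _ => 1) (v := fun _ => ξ) (x₀ := q)
    h.contMDiffAt contMDiffAt_const).congr_of_eventuallyEq ?_
  exact Filter.Eventually.of_forall fun x => TotalSpace.ext (one_smul G x).symm HEq.rfl

theorem contMDiff_standardMomentumMap (ξ : GroupLieAlgebra (𝓡 m) G) :
    ContMDiff (cotangentModel n) 𝓘(ℝ, ℝ) ∞
      (fun α : CotangentBundle n Q => standardMomentumMap m G α ξ) := fun α =>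
  contMDiffAt_id.cotangentBundle_pairing
    ((contMDiff_infinitesimalGenerator ξ).contMDiffAt.comp α
      contMDiff_cotangentBundle_proj.contMDiffAt)

/-- The generators of the cotangent-lifted action are the Hamiltonian vector fields of the functions
`J_ξ`. -/
theorem isHamiltonianVectorField_infinitesimalGenerator (ξ : GroupLieAlgebra (𝓡 m) G) :
    letI : MulAction G (CotangentBundle n Q) := cotangentLiftAction m G n Q
    IsHamiltonianVectorField (cotangentModel n) classicalBracket
      (infinitesimalGenerator (cotangentModel n) ξ)
      (fun α : CotangentBundle n Q => standardMomentumMap m G α ξ) := by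
  let _ : MulAction G (CotangentBundle n Q) := cotangentLiftAction m G n Q
  have : ContMDiffSMul (𝓡 m) (cotangentModel n) ∞ G (CotangentBundle n Q) :=
    contMDiffSMul_cotangentLiftAction m n G Q
  intro F hF α
  obtain ⟨c, hc, hξ⟩ := exists_contMDiffAt_path ξ
  have hc0 : c 0 = 1 := congrArg TotalSpace.proj hξ
  let e := chartAt (Model n) α.1
  have he : e ∈ IsManifold.maximalAtlas (𝓡 n) ∞ Q := IsManifold.chart_mem_maximalAtlas _
  have hα : α.1 ∈ e.source := mem_chart_source (Model n) α.1
  have hα0 := cotangentPoint_momentumCoord he hα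
  have hq : e α.1 ∈ e.target := e.map_source hα
  -- the momentum coordinates of the orbit of `α` along `c`
  let p : ℝ → Model n := fun t => momentumCoord e (c t • α)
  have hp0 : p 0 = momentumCoord e α := by
    change momentumCoord e (c 0 • α) = _
    rw [hc0, one_smul]
  have hp : DifferentiableAt ℝ p 0 := by
    have h1 : ContMDiffAt 𝓘(ℝ, ℝ) (𝓡 n) ∞ p 0 := by
      refine ContMDiffAt.comp 0 (contMDiffAt_momentumCoord he ?_) (hc.smul contMDiffAt_const)
      rwa [hc0, one_smul]
    exact h1.contDiffAt.differentiableAt (by simp)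
  have hnear : ∀ᶠ t in nhds (0 : ℝ), c t • α.1 ∈ e.source := by
    have h1 : ContinuousAt (fun t => c t • α.1) 0 :=
      (hc.smul (contMDiffAt_const (I' := 𝓡 n) (c := α.1))).continuousAt
    refine h1.eventually (e.open_source.mem_nhds ?_)
    change c 0 • α.1 ∈ e.source
    rwa [hc0, one_smul]
  have hpair : ∀ᶠ t in nhds 0, ∀ v, inner ℝ (p t)
      (fderiv ℝ (fun x => motionInChart e c (t, x)) (e α.1) v) = inner ℝ (p 0) v := by
    filter_upwards [hnear] with t ht v
    have h1 := inner_momentumCoord_cotangentLift he he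
      (Diffeomorph.smul (𝓡 m) (𝓡 n) ∞ (c t)⁻¹ : Q ≃ₘ^∞⟮𝓡 n, 𝓡 n⟯ Q) hq
      (by rwa [Diffeomorph.smul_inv_symm_apply, e.left_inv hα]) (momentumCoord e α) v
    simp only [hα0, Diffeomorph.smul_inv_symm_apply] at h1
    rw [hp0]
    exact h1
  have hk0 : ∀ᶠ x in nhds (e α.1), motionInChart e c (0, x) = x :=
    Filter.mem_of_superset (e.open_target.mem_nhds hq) fun x hx => motionInChart_zero hc0 hx
  have hk2 : ContDiffAt ℝ 2 (motionInChart e c) (0, e α.1) :=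
    (contDiffAt_motionInChart he hc hc0 hq).of_le ENat.LEInfty.out
  have hJ : (fun z : Model n × Model n => standardMomentumMap m G
      (cotangentPoint e z.1 z.2 : CotangentBundle n Q) ξ) =ᶠ[nhds (e α.1, p 0)]
      fun z => inner ℝ z.2 (fderiv ℝ (motionInChart e c) (0, z.1) (1, 0)) := by
    filter_upwards [continuous_fst.continuousAt.eventually (e.open_target.mem_nhds hq)] with z hz
    exact standardMomentumMap_cotangentPoint he hc hξ hz z.2
  let Fe : Model n × Model n → ℝ := fun z => F (cotangentPoint e z.1 z.2)
  -- both sides of the equation are the derivative of `Fe` in one direction of `ℝⁿ × ℝⁿ`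
  have hbracket : classicalBracket F (fun β => standardMomentumMap m G β ξ) α =
      fderiv ℝ Fe (e α.1, p 0)
        (fderiv ℝ (motionInChart e c) (0, e α.1) (1, 0), deriv p 0) := by
    refine (poissonBracketIn_eq_canonicalBivector he hα (hF α)
      (contMDiff_standardMomentumMap ξ α)).trans ?_
    rw [← hp0, hJ.fderiv_eq]
    exact canonicalBivector_fderiv_momentum hk2 hp.hasDerivAt hpair hk0 _
  have hFe : HasFDerivAt Fe (fderiv ℝ Fe (e α.1, p 0)) (motionInChart e c (0, e α.1), p 0) := by
    rw [motionInChart_zero hc0 hq, hp0]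
    exact ((hF α).differentiableAt_comp_cotangentPoint he hα).hasFDerivAt
  have hcurve : (fun t => F (c t • α)) =ᶠ[nhds 0]
      fun t => Fe (motionInChart e c (t, e α.1), p t) := by
    filter_upwards [hnear] with t ht
    have hb : (c t • α).1 = c t • α.1 := Diffeomorph.smul_inv_symm_apply (c t) α.1
    have h2 := cotangentPoint_momentumCoord he (α := c t • α) (by rwa [hb])
    rw [hb] at h2
    change F (c t • α) =
      F (cotangentPoint e (e (c t • e.symm (e α.1))) (momentumCoord e (c t • α)))
    rw [e.left_inv hα, h2]
  refine (mvfderiv_infinitesimalGenerator ((hF α).mdifferentiableAt (by simp))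
    (mdifferentiableAt_smul_right _ _) (hc.mdifferentiableAt (by simp)) hξ).trans ?_
  rw [hbracket, hcurve.deriv_eq]
  exact (HasFDerivAt.comp_hasDerivAt (0 : ℝ) hFe
    ((hasDerivAt_motionInChart he hc hc0 hq).prodMk hp.hasDerivAt)).deriv

end Action

end

theorem mainTheorem6 (m n : ℕ)
    (G : Type*) [TopologicalSpace G] [ChartedSpace (Model m) G] [Group G] [LieGroup (𝓡 m) ∞ G]
    (Q : Type*) [TopologicalSpace Q] [ChartedSpace (Model n) Q] [IsManifold (𝓡 n) ∞ Q]
    [MulAction G Q] [ContMDiffSMul (𝓡 m) (𝓡 n) ∞ G Q] :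
    letI : MulAction G (CotangentBundle n Q) := cotangentLiftAction m G n Q
    -- the classical bracket is given by the same formula in all cotangent-lifted coordinates
    (∀ e ∈ IsManifold.maximalAtlas (𝓡 n) ∞ Q, ∀ F K : CotangentBundle n Q → ℝ,
      ContMDiff (cotangentModel n) 𝓘(ℝ, ℝ) ∞ F → ContMDiff (cotangentModel n) 𝓘(ℝ, ℝ) ∞ K →
      ∀ α : CotangentBundle n Q, α.1 ∈ e.source →
        classicalBracket F K α = poissonBracketIn e F K α) ∧
    -- the cotangent-lifted action is smooth
    ContMDiffSMul (𝓡 m) (cotangentModel n) ∞ G (CotangentBundle n Q) ∧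
    -- `J` is the map with `J_ξ(α_q) = ⟨α_q, ξ_Q(q)⟩`, and it is a momentum map
    (∀ (ξ : GroupLieAlgebra (𝓡 m) G) (α : CotangentBundle n Q),
      standardMomentumMap m G α ξ = α.2 (infinitesimalGenerator (𝓡 n) ξ α.1)) ∧
    IsMomentumMap (cotangentModel n) classicalBracket
      (standardMomentumMap m G : CotangentBundle n Q → (GroupLieAlgebra (𝓡 m) G →L[ℝ] ℝ)) := by
  let _ : MulAction G (CotangentBundle n Q) := cotangentLiftAction m G n Q
  exact ⟨fun e he F K hF hK α hα => classicalBracket_eq_poissonBracketIn he hF hK hα,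
    contMDiffSMul_cotangentLiftAction m n G Q, fun _ _ => rfl,
    { canonical := isCanonicalAction_cotangentLiftAction m n G Q
      smooth := contMDiff_standardMomentumMap
      hamiltonian := isHamiltonianVectorField_infinitesimalGenerator }⟩
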